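/- Let $(X_i,Y_i)_{i\ge1}$ be i.i.d. random vectors in $\mathbb R^2$ whose common distribution function has continuous margins $F_X,F_Y$, and let $C(u,v)=\Pr(F_X(X_1)\le u,\,F_Y(Y_1)\le v)$ be their copula. For $p,q\in(0,1)$ put $$v(q\mid p;C)=\inf\{v\in[0,1]:\ C(p,v)/p\ge q\}.$$ With the pseudo-observations $U_{i,n}=n^{-1}\sum_{j=1}^n\mathbf 1\{X_j\le X_i\}$ and $V_{i,n}=n^{-1}\sum_{j=1}^n\mathbf 1\{Y_j\le Y_i\}$, let $\widehat C_n(u,v)=n^{-1}\sum_{i=1}^n\mathbf 1\{U_{i,n}\le u,\,V_{i,n}\le v\}$. For a sequence $(k_n)$ of real numbers (for instance positive integers) let $p_n=k_n/n$ and $\widehat A_{k_n,n}(v)=\widehat C_n(p_n,v)/p_n$. Let $A(v;\theta)$, $v\in[0,1]$, $\theta\in\Theta$, be a parametric model such that: 1. $\Theta\subset\mathbb R^d$ is non-empty, closed and bounded. 2. (Correct specification.) There is $\theta_0\in\Theta$ with $\lim_{p\downarrow0}C(p,v)/p=A(v;\theta_0)$ uniformly in $v\in(0,1)$. 3. For every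 $\theta\in\Theta$, $v\mapsto A(v;\theta)$ is a proper distribution function on $[0,1]$ (so $A(1;\theta)=1$), continuous and strictly increasing on $(0,1)$; and $(v,\theta)\mapsto A(v;\theta)$ is jointly continuous on $[0,1]\times\Theta$. 4. ($L^1$-identifiability.) For every $\varepsilon>0$, $\inf_{\theta\in\Theta,\ \|\theta-\theta_0\|\ge\varepsilon}\int_0^1|A(v;\theta)-A(v;\theta_0)|\,dv>0$ (the infimum over the empty set being $+\infty$). (Assumptions 2 and 3 place the limiting distribution $A(\cdot;\theta_0)$ in the tail-balance regime: it has no atom at $0$ or at $1$.) For each $n$ let $\hat\theta_n$ be almost surely a minimizer over $\Theta$ of $$Q_{k_n,n}(\theta)=\int_0^1\bigl|\widehat A_{k_n,n}(v)-A(v;\theta)\bigr|\,dv,$$ and let $\hat v_n(q\mid p_n)=A^{\leftarrow}(q;\hat\theta_n)=\inf\{v\in[0,1]:A(v;\hat\theta_n)\ge q\}$. If, as $n\to\infty$, $k_n\to\infty$, $k_n/n\to0$ and $k_n/\sqrt n\to\infty$, then $$\hat\theta_n\xrightarrow{P}\theta_0,\qquad\text{and for every fixed }q\in(0,1),\qquad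 \hat v_n(q\mid p_n)-v(q\mid p_n;C)\xrightarrow{P}0.$$ -/

import Mathlib

open MeasureTheory ProbabilityTheory Filter Topology Set

namespace CoVaR

noncomputable section

/-- The copula of a bivariate law `F` with continuous margins: the joint distribution function of
`(F_X(X), F_Y(Y))` for `(X, Y) ~ F`, where `F_X`, `F_Y` are the marginal distribution functions. -/
def copula (F : Measure (ℝ × ℝ)) (u v : ℝ) : ℝ :=
  F.real {z : ℝ × ℝ | cdf F.fst z.1 ≤ u ∧ cdf F.snd z.2 ≤ v}

/-- Generalized inverse of a function on the unit interval: `inf {v ∈ [0,1] : G v ≥ q}`. -/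
def genInv (G : ℝ → ℝ) (q : ℝ) : ℝ :=
  sInf {v : ℝ | v ∈ Icc (0 : ℝ) 1 ∧ q ≤ G v}

/-- The conditional distribution function `C(v | p) = C(p, v) / p`. -/
def condCopula (C : ℝ → ℝ → ℝ) (p v : ℝ) : ℝ := C p v / p

/-- The copula-adjusted probability level `v(q | p; C) = inf {v ∈ [0,1] : C(p, v) / p ≥ q}`. -/
def adjustedLevel (C : ℝ → ℝ → ℝ) (q p : ℝ) : ℝ := genInv (condCopula C p) q

/-- Rank-based pseudo-observation `n⁻¹ ∑_{j < n} 1{x_j ≤ x_i}`; the sample of size `n` is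
`x_0, …, x_{n-1}`. -/
def pseudoObs (x : ℕ → ℝ) (n i : ℕ) : ℝ :=
  (∑ j ∈ Finset.range n, if x j ≤ x i then (1 : ℝ) else 0) / n

open Classical in
/-- The empirical copula `n⁻¹ ∑_{i < n} 1{U_{i,n} ≤ u, V_{i,n} ≤ v}`. -/
def empCopula (x y : ℕ → ℝ) (n : ℕ) (u v : ℝ) : ℝ :=
  (∑ i ∈ Finset.range n,
    if pseudoObs x n i ≤ u ∧ pseudoObs y n i ≤ v then (1 : ℝ) else 0) / n

/-- The empirical conditional distribution function `Ĉ_n(k/n, v) / (k/n)`. -/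
def empCondCdf (x y : ℕ → ℝ) (n : ℕ) (k v : ℝ) : ℝ :=
  empCopula x y n (k / n) v / (k / n)

/-- The `L¹` minimum-distance criterion `∫₀¹ |Â_{k,n}(v) - A(v; θ)| dv`. -/
def criterion {E : Type*} (A : ℝ → E → ℝ) (x y : ℕ → ℝ) (n : ℕ) (k : ℝ) (θ : E) : ℝ :=
  ∫ v in (0 : ℝ)..1, |empCondCdf x y n k v - A v θ|

/-- `θ` is a minimizer over `Θ` of the criterion computed from the sample. -/
def IsMinDistEstimate {E : Type*} (Θ : Set E) (A : ℝ → E → ℝ) (x y : ℕ → ℝ) (n : ℕ) (k : ℝ)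
    (θ : E) : Prop :=
  θ ∈ Θ ∧ ∀ θ' ∈ Θ, criterion A x y n k θ ≤ criterion A x y n k θ'

/-- `G`, restricted to `[0,1]`, is the distribution function of a probability measure carried by
`[0,1]`. -/
structure IsProperCdf (G : ℝ → ℝ) : Prop where
  nonneg : 0 ≤ G 0
  mono : MonotoneOn G (Icc 0 1)
  right_cont : ∀ v ∈ Icc (0 : ℝ) 1, ContinuousWithinAt G (Icc v 1) v
  at_one : G 1 = 1

end

end CoVaR

namespace CoVaR

/-! Write `A₀ = A(·; θ₀)` and `p = k/n`. A rank condition `U_i ≤ p`, `V_i ≤ v` can be sandwiched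
between conditions on the true margins with slightly shrunk or enlarged thresholds. This bounds the
empirical copula by plain frequencies of fixed rectangles (`empCopula_le_freq`,
`freq_le_empCopula`), and Chebyshev controls these to precision `o(p)` because `k/√n → ∞`
(`holdsWHP_freq`). Dividing by `p` gives pointwise convergence to `A₀`; monotonicity and continuity
of `A₀` make it uniform (`IsSample.holdsWHP_abs_empCondCdf_sub_le`).

Since `θ₀` is a competitor in the minimization, `A(·; θhat)` is then `L¹`-close to `A₀`, and
identifiability forces `θhat` near `θ₀`. Finally, the fitted and the true conditional distribution
functions both converge pointwise to `A₀`, which crosses the level `q` strictly, so both inverses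
approach the same point (`exists_genInv_close`). -/

/-- The events `E n` hold with probability tending to one (no measurability required). -/
def HoldsWHP {Ω : Type*} [MeasurableSpace Ω] (P : Measure Ω) (E : ℕ → Ω → Prop) : Prop :=
  Tendsto (fun n => P {ω | ¬ E n ω}) atTop (𝓝 0)

/-! ### Calculus of events with probability tending to one. -/

section WHP

variable {Ω : Type*} [MeasurableSpace Ω] {P : Measure Ω}

lemma HoldsWHP.mono {E E' : ℕ → Ω → Prop} (h : HoldsWHP P E)
    (hsub : ∀ᶠ n in atTop, ∀ ω, E n ω → E' n ω) : HoldsWHP P E' := by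
  refine tendsto_of_tendsto_of_tendsto_of_le_of_le' tendsto_const_nhds h
    (Eventually.of_forall fun _ => zero_le) ?_
  filter_upwards [hsub] with n hn
  exact measure_mono fun ω hω hE => hω (hn ω hE)

lemma HoldsWHP.and {E E' : ℕ → Ω → Prop} (h : HoldsWHP P E) (h' : HoldsWHP P E') :
    HoldsWHP P (fun n ω => E n ω ∧ E' n ω) := by
  have hsum := Tendsto.add h h'
  rw [add_zero] at hsum
  refine tendsto_of_tendsto_of_tendsto_of_le_of_le tendsto_const_nhds hsum
    (fun _ => zero_le) fun n => ?_
  refine (measure_mono fun ω hω => ?_).trans (measure_union_le _ _)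
  by_cases h1 : E n ω
  · exact Or.inr fun h2 => hω ⟨h1, h2⟩
  · exact Or.inl h1

lemma HoldsWHP.of_ae {E : ℕ → Ω → Prop} (h : ∀ n, ∀ᵐ ω ∂P, E n ω) : HoldsWHP P E := by
  have h0 : (fun n => P {ω | ¬ E n ω}) = fun _ => 0 := funext fun n => ae_iff.1 (h n)
  unfold HoldsWHP
  rw [h0]
  exact tendsto_const_nhds

lemma HoldsWHP.of_forall {E : ℕ → Ω → Prop} (h : ∀ n ω, E n ω) : HoldsWHP P E :=
  HoldsWHP.of_ae fun n => Eventually.of_forall (h n)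

end WHP

/-! ### Chebyshev bounds for empirical frequencies. -/

section Frequency

open Classical in
/-- Relative frequency of the visits of `z 0, …, z (n - 1)` to `S`. -/
noncomputable def freq {α : Type*} (z : ℕ → α) (n : ℕ) (S : Set α) : ℝ :=
  (∑ i ∈ Finset.range n, if z i ∈ S then (1 : ℝ) else 0) / n

variable {Ω α : Type*} [MeasurableSpace Ω] [MeasurableSpace α] {P : Measure Ω}
  [IsProbabilityMeasure P] {F : Measure α} {Z : ℕ → Ω → α}

lemma measure_freq_deviation_le (hZ : ∀ i, Measurable (Z i)) (hindep : iIndepFun Z P)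
    (hlaw : ∀ i, P.map (Z i) = F) {S : Set α} (hS : MeasurableSet S) {n : ℕ} (hn : 0 < n)
    {t : ℝ} (ht : 0 < t) :
    P {ω | t ≤ |freq (fun i => Z i ω) n S - F.real S|} ≤ ENNReal.ofReal (1 / (n * t ^ 2)) := by
  classical
  have hn' : (0 : ℝ) < n := by exact_mod_cast hn
  set g : α → ℝ := fun z => if z ∈ S then (1 : ℝ) else 0 with hg
  have hgm : Measurable g := Measurable.ite hS measurable_const measurable_const
  set W : ℕ → Ω → ℝ := fun i => g ∘ Z i with hW
  have hWm : ∀ i, Measurable (W i) := fun i => hgm.comp (hZ i)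
  have hg01 : ∀ z, g z ∈ Icc (0 : ℝ) 1 := fun z => by
    simp only [hg]; split_ifs <;> simp
  have hL2 : ∀ i, MemLp (W i) 2 P := fun i =>
    MemLp.of_bound (hWm i).aestronglyMeasurable 1 (Eventually.of_forall fun ω => by
      have := hg01 (Z i ω)
      rw [Real.norm_eq_abs, abs_le]
      exact ⟨(by linarith [this.1] : -1 ≤ g (Z i ω)), this.2⟩)
  have hmean : ∀ i, ∫ ω, W i ω ∂P = F.real S := fun i => by
    have h1 : ∫ ω, W i ω ∂P = ∫ z, g z ∂(P.map (Z i)) :=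
      (integral_map (hZ i).aemeasurable hgm.aestronglyMeasurable).symm
    have h2 : g = S.indicator 1 := by
      ext z; simp [hg, indicator_apply]
    rw [h1, hlaw, h2, integral_indicator_one hS]
  have hvar : ∀ i, variance (W i) P ≤ 1 := fun i => by
    have := variance_le_sq_of_bounded (a := 0) (b := 1) (μ := P) (X := W i)
      (Eventually.of_forall fun ω => hg01 _) (hWm i).aemeasurable
    norm_num at this
    linarith
  have hsumvar : variance (∑ i ∈ Finset.range n, W i) P ≤ n := by
    rw [IndepFun.variance_sum (fun i _ => hL2 i) fun i _ j _ hij =>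
      (hindep.indepFun hij).comp hgm hgm]
    calc _ ≤ ∑ i ∈ Finset.range n, (1 : ℝ) := Finset.sum_le_sum fun i _ => hvar i
      _ = n := by simp
  have hsummean : ∫ ω, (∑ i ∈ Finset.range n, W i) ω ∂P = n * F.real S := by
    simp only [Finset.sum_apply]
    rw [integral_finsetSum _ fun i _ => (hL2 i).integrable one_le_two]
    simp [hmean]
  have hcheb := meas_ge_le_variance_div_sq (memLp_finsetSum' (Finset.range n) fun i _ => hL2 i)
    (mul_pos hn' ht)
  refine (measure_mono fun ω hω => ?_).trans (hcheb.trans (ENNReal.ofReal_le_ofReal ?_))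
  · simp only [mem_ofPred_eq] at hω ⊢
    rw [hsummean]
    have : (∑ i ∈ Finset.range n, W i) ω - n * F.real S
        = n * (freq (fun i => Z i ω) n S - F.real S) := by
      simp only [freq, Finset.sum_apply, hW, Function.comp, hg]
      field_simp
    rw [this, abs_mul, abs_of_pos hn']
    exact mul_le_mul_of_nonneg_left hω hn'.le
  · calc _ ≤ (n : ℝ) / (n * t) ^ 2 := by gcongr
      _ = 1 / (n * t ^ 2) := by field_simp

/-- With `t = η k/n` the Chebyshev bound is `1 / (η² (k/√n)²)`. The variance was bounded by `1`
whatever the probability of the set, hence the need for `k/√n → ∞`. -/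
lemma holdsWHP_freq (hZ : ∀ i, Measurable (Z i)) (hindep : iIndepFun Z P)
    (hlaw : ∀ i, P.map (Z i) = F) {S : ℕ → Set α} (hS : ∀ n, MeasurableSet (S n))
    {k : ℕ → ℝ} (hk : Tendsto k atTop atTop)
    (hksqrt : Tendsto (fun n : ℕ => k n / Real.sqrt n) atTop atTop) {η : ℝ} (hη : 0 < η) :
    HoldsWHP P fun n ω =>
      |freq (fun i => Z i ω) n (S n) - F.real (S n)| < η * (k n / n) := by
  have hlim : Tendsto (fun n : ℕ => ENNReal.ofReal (1 / (η ^ 2 * (k n / Real.sqrt n) ^ 2)))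
      atTop (𝓝 0) := by
    rw [← ENNReal.ofReal_zero]
    refine ENNReal.tendsto_ofReal ?_
    simp only [one_div]
    exact tendsto_inv_atTop_zero.comp
      (Tendsto.const_mul_atTop (by positivity) ((tendsto_pow_atTop two_ne_zero).comp hksqrt))
  refine tendsto_of_tendsto_of_tendsto_of_le_of_le' tendsto_const_nhds hlim
    (Eventually.of_forall fun _ => zero_le) ?_
  filter_upwards [eventually_gt_atTop 0, hk.eventually_gt_atTop 0] with n hn hkn
  have hn' : (0 : ℝ) < n := by exact_mod_cast hn
  simp only [not_lt]
  refine (measure_freq_deviation_le hZ hindep hlaw (hS n) hn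
    (mul_pos hη (div_pos hkn hn'))).trans (ENNReal.ofReal_le_ofReal (le_of_eq ?_))
  have : (k n / Real.sqrt n) ^ 2 = k n ^ 2 / n := by
    rw [div_pow, Real.sq_sqrt hn'.le]
  rw [this]
  field_simp

end Frequency

/-! ### Deterministic comparison of ranks with marginal thresholds. -/

section Ranks

lemma pseudoObs_le_freq {g : ℝ → ℝ} (hg : Monotone g) (x : ℕ → ℝ) (n : ℕ) {i : ℕ} {s : ℝ}
    (hi : g (x i) ≤ s) : pseudoObs x n i ≤ freq x n {r | g r ≤ s} := by
  classical
  unfold pseudoObs freq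
  gcongr with j _
  by_cases h : x j ≤ x i
  · have : x j ∈ {r | g r ≤ s} := (hg h).trans hi
    simp [h, this]
  · rw [if_neg h]; split_ifs <;> norm_num

lemma freq_le_pseudoObs {g : ℝ → ℝ} (hg : Monotone g) (x : ℕ → ℝ) (n : ℕ) {i : ℕ} {s : ℝ}
    (hi : s < g (x i)) : freq x n {r | g r ≤ s} ≤ pseudoObs x n i := by
  classical
  unfold pseudoObs freq
  gcongr with j _
  by_cases h : x j ∈ {r | g r ≤ s}
  · have hlt : g (x j) < g (x i) := lt_of_le_of_lt h hi
    simp [h, (hg.reflect_lt hlt).le]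
  · rw [if_neg h]; split_ifs <;> norm_num

/-- If `g (x i)` exceeded `a`, every point counted in the frequency of `{g ≤ a}` would lie below `x
i`, so its rank would exceed `p`. The same holds for `y`. -/
lemma empCopula_le_freq {g h : ℝ → ℝ} (hg : Monotone g) (hh : Monotone h) (x y : ℕ → ℝ) (n : ℕ)
    {p v a b : ℝ} (ha : p < freq x n {r | g r ≤ a}) (hb : v < freq y n {r | h r ≤ b}) :
    empCopula x y n p v ≤ freq (fun i => (x i, y i)) n {z | g z.1 ≤ a ∧ h z.2 ≤ b} := by
  classical
  unfold empCopula
  rw [freq]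
  gcongr with i _
  by_cases hi : pseudoObs x n i ≤ p ∧ pseudoObs y n i ≤ v
  · have h1 : g (x i) ≤ a := by
      by_contra! hc
      linarith [freq_le_pseudoObs hg x n hc, hi.1]
    have h2 : h (y i) ≤ b := by
      by_contra! hc
      linarith [freq_le_pseudoObs hh y n hc, hi.2]
    simp [hi, h1, h2]
  · rw [if_neg hi]; split_ifs <;> norm_num

/-- Serves the endpoint `v = 1`, where no frequency can exceed `v` and `empCopula_le_freq` is void.
-/
lemma empCopula_le_freq_fst {g : ℝ → ℝ} (hg : Monotone g) (x y : ℕ → ℝ) (n : ℕ)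
    {p v a : ℝ} (ha : p < freq x n {r | g r ≤ a}) :
    empCopula x y n p v ≤ freq x n {r | g r ≤ a} := by
  classical
  unfold empCopula
  rw [freq] at ha ⊢
  gcongr with i _
  by_cases hi : pseudoObs x n i ≤ p ∧ pseudoObs y n i ≤ v
  · have h1 : g (x i) ≤ a := by
      by_contra! hc
      have := freq_le_pseudoObs hg x n hc
      rw [freq] at this
      linarith [hi.1]
    simp [hi, h1]
  · rw [if_neg hi]; split_ifs <;> norm_num

lemma freq_le_empCopula {g h : ℝ → ℝ} (hg : Monotone g) (hh : Monotone h) (x y : ℕ → ℝ) (n : ℕ)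
    {p v a b : ℝ} (ha : freq x n {r | g r ≤ a} ≤ p) (hb : freq y n {r | h r ≤ b} ≤ v) :
    freq (fun i => (x i, y i)) n {z | g z.1 ≤ a ∧ h z.2 ≤ b} ≤ empCopula x y n p v := by
  classical
  unfold empCopula
  rw [freq]
  gcongr with i _
  by_cases hi : g (x i) ≤ a ∧ h (y i) ≤ b
  · have h1 := (pseudoObs_le_freq hg x n hi.1).trans ha
    have h2 := (pseudoObs_le_freq hh y n hi.2).trans hb
    simp [hi, h1, h2]
  · rw [if_neg (by simpa using hi)]; split_ifs <;> norm_num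

lemma empCopula_nonneg (x y : ℕ → ℝ) (n : ℕ) (u v : ℝ) : 0 ≤ empCopula x y n u v := by
  classical
  unfold empCopula
  exact div_nonneg (Finset.sum_nonneg fun i _ => by split_ifs <;> norm_num) n.cast_nonneg

lemma empCopula_mono (x y : ℕ → ℝ) (n : ℕ) (u : ℝ) : Monotone (empCopula x y n u) := by
  classical
  intro v w hvw
  unfold empCopula
  gcongr with i _
  by_cases hi : pseudoObs x n i ≤ u ∧ pseudoObs y n i ≤ v
  · have : pseudoObs y n i ≤ w := hi.2.trans hvw
    simp [hi, this]
  · rw [if_neg hi]; split_ifs <;> norm_num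

lemma empCondCdf_nonneg (x y : ℕ → ℝ) (n : ℕ) {k : ℝ} (hk : 0 ≤ k) (v : ℝ) :
    0 ≤ empCondCdf x y n k v :=
  div_nonneg (empCopula_nonneg ..) (by positivity)

lemma empCondCdf_mono (x y : ℕ → ℝ) (n : ℕ) {k : ℝ} (hk : 0 ≤ k) :
    Monotone (empCondCdf x y n k) := fun _ _ h =>
  div_le_div_of_nonneg_right (empCopula_mono x y n _ h) (by positivity)

end Ranks

/-! ### Uniform margins and elementary copula bounds. -/

section Copula

/-- The distribution function may have flat pieces, so the sublevel set is compared with half-lines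
`Iic x` where `cdf μ x` equals `u` (from inside) or some `w > u` (from outside). -/
lemma measureReal_cdf_le {μ : Measure ℝ} [IsProbabilityMeasure μ] (hμ : Continuous (cdf μ)) {u : ℝ}
    (hu : u ∈ Ioo (0 : ℝ) 1) : μ.real {x | cdf μ x ≤ u} = u := by
  have hex : ∀ w ∈ Ioo (0 : ℝ) 1, ∃ x, cdf μ x = w := fun w hw =>
    mem_range_of_exists_le_of_exists_ge hμ
      ((tendsto_cdf_atBot μ).eventually_le_const hw.1).exists
      ((tendsto_cdf_atTop μ).eventually_const_le hw.2).exists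
  apply le_antisymm
  · refine le_of_forall_gt_imp_ge_of_dense fun w hw => ?_
    rcases lt_or_ge w 1 with hw1 | hw1
    · obtain ⟨x, rfl⟩ := hex w ⟨hu.1.trans hw, hw1⟩
      rw [cdf_eq_real μ x]
      refine measureReal_mono fun r hr => ?_
      exact ((monotone_cdf μ).reflect_lt (lt_of_le_of_lt hr hw)).le
    · exact measureReal_le_one.trans hw1
  · obtain ⟨x, rfl⟩ := hex u hu
    nth_rewrite 1 [cdf_eq_real μ x]
    exact measureReal_mono fun r hr => monotone_cdf μ hr

lemma measurableSet_cdf_le (μ : Measure ℝ) (u : ℝ) : MeasurableSet {x | cdf μ x ≤ u} :=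
  measurableSet_le (monotone_cdf μ).measurable measurable_const

lemma measurableSet_copula (F : Measure (ℝ × ℝ)) (u v : ℝ) :
    MeasurableSet {z : ℝ × ℝ | cdf F.fst z.1 ≤ u ∧ cdf F.snd z.2 ≤ v} :=
  (measurable_fst (measurableSet_cdf_le F.fst u)).inter
    (measurable_snd (measurableSet_cdf_le F.snd v))

variable (F : Measure (ℝ × ℝ)) [IsProbabilityMeasure F]

lemma copula_mono_right (u : ℝ) : Monotone (copula F u) := fun _ _ h =>
  measureReal_mono fun _ hz => ⟨hz.1, hz.2.trans h⟩

lemma copula_le_right (hFY : Continuous (cdf F.snd)) (u : ℝ) {v : ℝ} (hv : v ∈ Ioo (0 : ℝ) 1) :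
    copula F u v ≤ v := by
  conv_rhs => rw [← measureReal_cdf_le hFY hv]
  rw [measureReal_def F.snd, Measure.snd_apply (measurableSet_cdf_le _ _), ← measureReal_def]
  exact measureReal_mono fun z hz => hz.2

end Copula

/-! ### Locating generalized inverses. -/

section Inverse

/-- Two strict inequalities at `a < b` locate the generalized inverse of a nondecreasing function. -/
lemma genInv_mem_Icc {G : ℝ → ℝ} (hG : MonotoneOn G (Icc 0 1)) {a b q : ℝ}
    (ha : a ∈ Icc (0 : ℝ) 1) (hb : b ∈ Icc (0 : ℝ) 1) (hqa : G a < q) (hqb : q ≤ G b) :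
    genInv G q ∈ Icc a b := by
  have hmem : b ∈ {v : ℝ | v ∈ Icc (0 : ℝ) 1 ∧ q ≤ G v} := ⟨hb, hqb⟩
  constructor
  · refine le_csInf ⟨b, hmem⟩ fun v hv => ?_
    by_contra! hlt
    linarith [hG hv.1 ha hlt.le, hv.2]
  · exact csInf_le ⟨0, fun v hv => hv.1.1⟩ hmem

end Inverse

/-! ### Consistency of the empirical conditional distribution function. -/

section Sample

/-- `(X i, Y i)` are i.i.d. random vectors with common law `F`. -/
structure IsSample {Ω : Type*} [MeasurableSpace Ω] (P : Measure Ω) (F : Measure (ℝ × ℝ))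
    (X Y : ℕ → Ω → ℝ) : Prop where
  measurable_left : ∀ i, Measurable (X i)
  measurable_right : ∀ i, Measurable (Y i)
  indep : iIndepFun (fun i ω => (X i ω, Y i ω)) P
  law : ∀ i, P.map (fun ω => (X i ω, Y i ω)) = F

/-- An intermediate sequence growing faster than `√n`. -/
structure IsIntermediate (k : ℕ → ℝ) : Prop where
  tendsto_atTop : Tendsto k atTop atTop
  div_tendsto_zero : Tendsto (fun n : ℕ => k n / n) atTop (𝓝 0)
  div_sqrt_tendsto : Tendsto (fun n : ℕ => k n / Real.sqrt n) atTop atTop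

lemma IsIntermediate.tendsto_nhdsGT {k : ℕ → ℝ} (hk : IsIntermediate k) :
    Tendsto (fun n : ℕ => k n / n) atTop (𝓝[>] 0) := by
  refine tendsto_nhdsWithin_iff.2 ⟨hk.div_tendsto_zero, ?_⟩
  filter_upwards [hk.tendsto_atTop.eventually_gt_atTop 0, eventually_gt_atTop 0] with n h1 h2
  exact div_pos h1 (by exact_mod_cast h2)

variable {Ω : Type*} [MeasurableSpace Ω] {P : Measure Ω} [IsProbabilityMeasure P]
  {F : Measure (ℝ × ℝ)} {X Y : ℕ → Ω → ℝ} {k : ℕ → ℝ}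

lemma IsSample.holdsWHP_freq_fst (hs : IsSample P F X Y) (hk : IsIntermediate k)
    {S : ℕ → Set ℝ} (hS : ∀ n, MeasurableSet (S n)) {η : ℝ} (hη : 0 < η) :
    HoldsWHP P fun n ω =>
      |freq (fun i => X i ω) n (S n) - F.fst.real (S n)| < η * (k n / n) := by
  refine holdsWHP_freq hs.measurable_left (hs.indep.comp (fun _ => Prod.fst)
    fun _ => measurable_fst) (fun i => ?_) hS hk.tendsto_atTop hk.div_sqrt_tendsto hη
  rw [← hs.law i, Measure.fst, Measure.map_map measurable_fst
    ((hs.measurable_left i).prodMk (hs.measurable_right i))]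
  rfl

lemma IsSample.holdsWHP_freq_snd (hs : IsSample P F X Y) (hk : IsIntermediate k)
    {S : ℕ → Set ℝ} (hS : ∀ n, MeasurableSet (S n)) {η : ℝ} (hη : 0 < η) :
    HoldsWHP P fun n ω =>
      |freq (fun i => Y i ω) n (S n) - F.snd.real (S n)| < η * (k n / n) := by
  refine holdsWHP_freq hs.measurable_right (hs.indep.comp (fun _ => Prod.snd)
    fun _ => measurable_snd) (fun i => ?_) hS hk.tendsto_atTop hk.div_sqrt_tendsto hη
  rw [← hs.law i, Measure.snd, Measure.map_map measurable_snd
    ((hs.measurable_left i).prodMk (hs.measurable_right i))]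
  rfl

lemma IsSample.holdsWHP_freq_copula (hs : IsSample P F X Y) (hk : IsIntermediate k)
    (u v : ℕ → ℝ) {η : ℝ} (hη : 0 < η) :
    HoldsWHP P fun n ω =>
      |freq (fun i => (X i ω, Y i ω)) n
        {z | cdf F.fst z.1 ≤ u n ∧ cdf F.snd z.2 ≤ v n} - copula F (u n) (v n)|
        < η * (k n / n) :=
  holdsWHP_freq (fun i => (hs.measurable_left i).prodMk (hs.measurable_right i)) hs.indep hs.law
    (fun n => measurableSet_copula F (u n) (v n)) hk.tendsto_atTop hk.div_sqrt_tendsto hη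

variable {A₀ : ℝ → ℝ}

/-- Rescaling: `C(cp, v)/p = c · C(cp, v)/(cp)`. -/
lemma tendsto_copula_scaled (hA : ∀ v ∈ Ioo (0 : ℝ) 1,
      Tendsto (fun p => copula F p v / p) (𝓝[>] 0) (𝓝 (A₀ v)))
    (hk : IsIntermediate k) {c v : ℝ} (hc : 0 < c) (hv : v ∈ Ioo (0 : ℝ) 1) :
    Tendsto (fun n : ℕ => copula F (c * (k n / n)) v / (k n / n)) atTop (𝓝 (c * A₀ v)) := by
  have h1 : Tendsto (fun n : ℕ => c * (k n / n)) atTop (𝓝[>] 0) := by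
    refine tendsto_nhdsWithin_iff.2 ⟨by simpa using hk.div_tendsto_zero.const_mul c, ?_⟩
    filter_upwards [hk.tendsto_nhdsGT self_mem_nhdsWithin] with n h0
    exact mul_pos hc h0
  refine (((hA v hv).comp h1).const_mul c).congr fun n => ?_
  simp only [Function.comp]
  rw [mul_div_assoc', mul_div_mul_left _ _ hc.ne']

variable [IsProbabilityMeasure F]

lemma IsSample.holdsWHP_margin_fst (hs : IsSample P F X Y) (hk : IsIntermediate k)
    (hFX : Continuous (cdf F.fst)) {c η : ℝ} (hc : 0 < c) (hη : 0 < η) :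
    HoldsWHP P fun n ω =>
      |freq (fun i => X i ω) n {r | cdf F.fst r ≤ c * (k n / n)} - c * (k n / n)|
        < η * (k n / n) := by
  refine (hs.holdsWHP_freq_fst hk (fun n => measurableSet_cdf_le F.fst (c * (k n / n))) hη).mono ?_
  have h1 := hk.div_tendsto_zero.eventually_lt_const (inv_pos.2 hc)
  filter_upwards [hk.tendsto_nhdsGT self_mem_nhdsWithin, h1] with n h0 h1 ω h
  have h0' : 0 < k n / n := h0
  rwa [measureReal_cdf_le hFX ⟨mul_pos hc h0', ?_⟩] at h
  calc c * (k n / n) < c * c⁻¹ := by gcongr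
    _ = 1 := mul_inv_cancel₀ hc.ne'

lemma IsSample.holdsWHP_margin_snd (hs : IsSample P F X Y) (hk : IsIntermediate k)
    (hFY : Continuous (cdf F.snd)) {v η : ℝ} (hv : v ∈ Ioo (0 : ℝ) 1) (hη : 0 < η) :
    HoldsWHP P fun n ω => |freq (fun i => Y i ω) n {r | cdf F.snd r ≤ v} - v| < η := by
  refine (hs.holdsWHP_freq_snd hk (fun _ => measurableSet_cdf_le F.snd v) one_pos).mono ?_
  filter_upwards [hk.div_tendsto_zero.eventually_lt_const hη] with n h1 ω h
  rw [measureReal_cdf_le hFY hv, one_mul] at h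
  exact h.trans h1

lemma IsSample.holdsWHP_empCondCdf_le (hs : IsSample P F X Y) (hk : IsIntermediate k)
    (hFX : Continuous (cdf F.fst)) (hFY : Continuous (cdf F.snd))
    (hA : ∀ v ∈ Ioo (0 : ℝ) 1, Tendsto (fun p => copula F p v / p) (𝓝[>] 0) (𝓝 (A₀ v)))
    {v : ℝ} (hv : v ∈ Ioo (0 : ℝ) 1) (hcont : ContinuousAt A₀ v) {η : ℝ} (hη : 0 < η) :
    HoldsWHP P fun n ω =>
      empCondCdf (fun i => X i ω) (fun i => Y i ω) n (k n) v ≤ A₀ v + η := by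
  -- Thresholds are enlarged to `(1 + ε) p` and `v + ε`, so that marginal errors `ε p` and `ε` still
  -- leave the frequencies above `p` and `v`. The two extra `ε` pay for the copula limit and for the
  -- sampling error of the rectangle.
  obtain ⟨ε, hε, hε1, hεη⟩ : ∃ ε > 0, ε < 1 - v ∧
      (1 + ε) * A₀ (v + ε) + ε + ε < A₀ v + η := by
    have hlim : Tendsto (fun ε : ℝ => (1 + ε) * A₀ (v + ε) + ε + ε) (𝓝 0) (𝓝 (A₀ v)) := by
      have h1 : Tendsto (fun ε : ℝ => v + ε) (𝓝 0) (𝓝 v) :=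
        Continuous.tendsto' (by fun_prop) _ _ (by simp)
      have h2 : Tendsto (fun ε : ℝ => 1 + ε) (𝓝 0) (𝓝 1) :=
        Continuous.tendsto' (by fun_prop) _ _ (by simp)
      simpa using ((h2.mul (hcont.tendsto.comp h1)).add tendsto_id).add tendsto_id
    have h3 : ∀ᶠ ε : ℝ in 𝓝[>] 0, (1 + ε) * A₀ (v + ε) + ε + ε < A₀ v + η :=
      (hlim.eventually_lt_const (by linarith)).filter_mono nhdsWithin_le_nhds
    have h4 : ∀ᶠ ε : ℝ in 𝓝[>] 0, ε < 1 - v :=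
      (tendsto_id.eventually_lt_const (by linarith [hv.2] : (0 : ℝ) < 1 - v)).filter_mono
        nhdsWithin_le_nhds
    obtain ⟨ε, ⟨h3, h4⟩, h5⟩ := ((h3.and h4).and self_mem_nhdsWithin).exists
    exact ⟨ε, h5, h4, h3⟩
  have hvε : v + ε ∈ Ioo (0 : ℝ) 1 := ⟨by linarith [hv.1], by linarith⟩
  have hc : 0 < 1 + ε := by linarith
  refine (((hs.holdsWHP_margin_fst hk hFX hc hε).and
    (hs.holdsWHP_margin_snd hk hFY hvε hε)).and
    (hs.holdsWHP_freq_copula hk (fun n => (1 + ε) * (k n / n)) (fun _ => v + ε) hε)).mono ?_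
  filter_upwards [hk.tendsto_nhdsGT self_mem_nhdsWithin,
    (tendsto_copula_scaled hA hk hc hvε).eventually_lt_const (lt_add_of_pos_right _ hε)]
    with n h0 hC ω ⟨⟨h1, h2⟩, h3⟩
  have h0' : 0 < k n / n := h0
  rw [abs_lt] at h1 h2 h3
  have hle := empCopula_le_freq (monotone_cdf F.fst) (monotone_cdf F.snd) (fun i => X i ω)
    (fun i => Y i ω) n (p := k n / n) (v := v) (a := (1 + ε) * (k n / n)) (b := v + ε)
    (by linarith [h1.1]) (by linarith [h2.1])
  rw [div_lt_iff₀ h0'] at hC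
  rw [empCondCdf, div_le_iff₀ h0']
  calc _ ≤ ((1 + ε) * A₀ (v + ε) + ε + ε) * (k n / n) := by linarith [h3.2]
    _ ≤ _ := by gcongr

lemma IsSample.holdsWHP_empCondCdf_one_le (hs : IsSample P F X Y) (hk : IsIntermediate k)
    (hFX : Continuous (cdf F.fst)) {η : ℝ} (hη : 0 < η) :
    HoldsWHP P fun n ω =>
      empCondCdf (fun i => X i ω) (fun i => Y i ω) n (k n) 1 ≤ 1 + η := by
  refine (hs.holdsWHP_margin_fst hk hFX (by linarith : 0 < 1 + η / 2) (half_pos hη)).mono ?_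
  filter_upwards [hk.tendsto_nhdsGT self_mem_nhdsWithin] with n h0 ω h1
  have h0' : 0 < k n / n := h0
  rw [abs_lt] at h1
  have hle := empCopula_le_freq_fst (monotone_cdf F.fst) (fun i => X i ω)
    (fun i => Y i ω) n (p := k n / n) (v := 1) (a := (1 + η / 2) * (k n / n)) (by linarith [h1.1])
  rw [empCondCdf, div_le_iff₀ h0']
  linarith [h1.2]

lemma IsSample.holdsWHP_le_empCondCdf (hs : IsSample P F X Y) (hk : IsIntermediate k)
    (hFX : Continuous (cdf F.fst)) (hFY : Continuous (cdf F.snd))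
    (hA : ∀ v ∈ Ioo (0 : ℝ) 1, Tendsto (fun p => copula F p v / p) (𝓝[>] 0) (𝓝 (A₀ v)))
    {v : ℝ} (hv : v ∈ Ioo (0 : ℝ) 1) (hcont : ContinuousAt A₀ v) {η : ℝ} (hη : 0 < η) :
    HoldsWHP P fun n ω =>
      A₀ v - η ≤ empCondCdf (fun i => X i ω) (fun i => Y i ω) n (k n) v := by
  obtain ⟨ε, hε, hε1, hε2, hεη⟩ : ∃ ε > 0, ε < v ∧ ε < 1 ∧
      A₀ v - η < (1 - ε) * A₀ (v - ε) - ε - ε := by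
    have hlim : Tendsto (fun ε : ℝ => (1 - ε) * A₀ (v - ε) - ε - ε) (𝓝 0) (𝓝 (A₀ v)) := by
      have h1 : Tendsto (fun ε : ℝ => v - ε) (𝓝 0) (𝓝 v) :=
        Continuous.tendsto' (by fun_prop) _ _ (by simp)
      have h2 : Tendsto (fun ε : ℝ => 1 - ε) (𝓝 0) (𝓝 1) :=
        Continuous.tendsto' (by fun_prop) _ _ (by simp)
      simpa using ((h2.mul (hcont.tendsto.comp h1)).sub tendsto_id).sub tendsto_id
    have h3 : ∀ᶠ ε : ℝ in 𝓝[>] 0, A₀ v - η < (1 - ε) * A₀ (v - ε) - ε - ε :=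
      (hlim.eventually_const_lt (by linarith)).filter_mono nhdsWithin_le_nhds
    have h4 : ∀ᶠ ε : ℝ in 𝓝[>] 0, ε < v :=
      (tendsto_id.eventually_lt_const hv.1).filter_mono nhdsWithin_le_nhds
    obtain ⟨ε, ⟨h3, h4⟩, h5⟩ := ((h3.and h4).and self_mem_nhdsWithin).exists
    exact ⟨ε, h5, h4, h4.trans hv.2, h3⟩
  have hvε : v - ε ∈ Ioo (0 : ℝ) 1 := ⟨by linarith [hv.1], by linarith [hv.2]⟩
  have hc : 0 < 1 - ε := by linarith
  refine (((hs.holdsWHP_margin_fst hk hFX hc hε).and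
    (hs.holdsWHP_margin_snd hk hFY hvε hε)).and
    (hs.holdsWHP_freq_copula hk (fun n => (1 - ε) * (k n / n)) (fun _ => v - ε) hε)).mono ?_
  filter_upwards [hk.tendsto_nhdsGT self_mem_nhdsWithin,
    (tendsto_copula_scaled hA hk hc hvε).eventually_const_lt (sub_lt_self _ hε)]
    with n h0 hC ω ⟨⟨h1, h2⟩, h3⟩
  have h0' : 0 < k n / n := h0
  rw [abs_lt] at h1 h2 h3
  have hle := freq_le_empCopula (monotone_cdf F.fst) (monotone_cdf F.snd) (fun i => X i ω)
    (fun i => Y i ω) n (p := k n / n) (v := v) (a := (1 - ε) * (k n / n)) (b := v - ε)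
    (by linarith [h1.2]) (by linarith [h2.2])
  rw [lt_div_iff₀ h0'] at hC
  rw [empCondCdf, le_div_iff₀ h0']
  calc _ ≤ ((1 - ε) * A₀ (v - ε) - ε - ε) * (k n / n) := by gcongr
    _ ≤ _ := by linarith [h3.1]

/-- The empirical conditional distribution function is uniformly consistent. -/
theorem IsSample.holdsWHP_abs_empCondCdf_sub_le (hs : IsSample P F X Y) (hk : IsIntermediate k)
    (hFX : Continuous (cdf F.fst)) (hFY : Continuous (cdf F.snd))
    (hA : ∀ v ∈ Ioo (0 : ℝ) 1, Tendsto (fun p => copula F p v / p) (𝓝[>] 0) (𝓝 (A₀ v)))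
    (hcont : ContinuousOn A₀ (Icc 0 1)) (h0 : A₀ 0 = 0) (h1 : A₀ 1 = 1) {η : ℝ} (hη : 0 < η) :
    HoldsWHP P fun n ω => ∀ v ∈ Icc (0 : ℝ) 1,
      |empCondCdf (fun i => X i ω) (fun i => Y i ω) n (k n) v - A₀ v| ≤ η := by
  have hcontAt : ∀ v ∈ Ioo (0 : ℝ) 1, ContinuousAt A₀ v := fun v hv =>
    hcont.continuousAt (Icc_mem_nhds hv.1 hv.2)
  have hup : ∀ b ∈ Ioc (0 : ℝ) 1, HoldsWHP P fun n ω =>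
      empCondCdf (fun i => X i ω) (fun i => Y i ω) n (k n) b ≤ A₀ b + η / 3 := by
    intro b hb
    rcases hb.2.lt_or_eq with hb1 | rfl
    · exact hs.holdsWHP_empCondCdf_le hk hFX hFY hA ⟨hb.1, hb1⟩ (hcontAt b ⟨hb.1, hb1⟩)
        (by linarith)
    · rw [h1]
      exact hs.holdsWHP_empCondCdf_one_le hk hFX (by linarith)
  have hkpos : ∀ᶠ n in atTop, 0 ≤ k n := hk.tendsto_atTop.eventually_ge_atTop 0
  have hlow : ∀ a ∈ Ico (0 : ℝ) 1, HoldsWHP P fun n ω =>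
      A₀ a - η / 3 ≤ empCondCdf (fun i => X i ω) (fun i => Y i ω) n (k n) a := by
    intro a ha
    rcases ha.1.lt_or_eq with ha0 | rfl
    · exact hs.holdsWHP_le_empCondCdf hk hFX hFY hA ⟨ha0, ha.2⟩ (hcontAt a ⟨ha0, ha.2⟩)
        (by linarith)
    -- At `a = 0` the lower bound is free, as `A₀ 0 = 0`.
    · refine (HoldsWHP.of_forall (E := fun _ _ => True) fun _ _ => trivial).mono ?_
      filter_upwards [hkpos] with n hn ω _
      rw [h0]
      linarith [empCondCdf_nonneg (fun i => X i ω) (fun i => Y i ω) n hn 0]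
  -- Pólya's argument: the property passes to finite unions, so it suffices to treat a window around
  -- each point on which `A₀` varies by less than `η / 3` from its centre.
  refine isCompact_Icc.induction_on (p := fun s => HoldsWHP P fun n ω => ∀ v ∈ s,
      |empCondCdf (fun i => X i ω) (fun i => Y i ω) n (k n) v - A₀ v| ≤ η) ?_ ?_ ?_ ?_
  · exact HoldsWHP.of_forall fun _ _ _ hv => hv.elim
  · exact fun s t hst ht => ht.mono (Eventually.of_forall fun n ω h v hv => h v (hst hv))
  · exact fun s t hs ht => (hs.and ht).mono
      (Eventually.of_forall fun n ω h v hv => hv.elim (h.1 v) (h.2 v))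
  intro v hv
  obtain ⟨δ, hδ, hball⟩ := Metric.continuousOn_iff.1 hcont v hv (η / 3) (by linarith)
  set a := max 0 (v - δ / 2) with ha
  set b := min 1 (v + δ / 2) with hb
  have ha0 : 0 ≤ a := le_max_left _ _
  have hav : a ≤ v := max_le hv.1 (by linarith)
  have ha1 : a < 1 := max_lt one_pos (by linarith [hv.2])
  have hb1 : b ≤ 1 := min_le_left _ _
  have hvb : v ≤ b := le_min hv.2 (by linarith)
  have hb0 : 0 < b := lt_min one_pos (by linarith [hv.1])
  have hwin : ∀ w ∈ Icc a b, |A₀ w - A₀ v| < η / 3 := by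
    intro w hw
    have hwa : v - δ / 2 ≤ w := (le_max_right _ _).trans hw.1
    have hwb : w ≤ v + δ / 2 := hw.2.trans (min_le_right _ _)
    rw [← Real.dist_eq]
    refine hball w ⟨ha0.trans hw.1, hw.2.trans hb1⟩ ?_
    rw [Real.dist_eq, abs_lt]
    constructor <;> linarith
  refine ⟨Icc a b, ?_, ((hup b ⟨hb0, hb1⟩).and (hlow a ⟨ha0, ha1⟩)).mono ?_⟩
  · refine mem_nhdsWithin.2 ⟨Ioo (v - δ / 2) (v + δ / 2), isOpen_Ioo,
      ⟨by linarith, by linarith⟩, fun w hw => ⟨max_le hw.2.1 hw.1.1.le, le_min hw.2.2 hw.1.2.le⟩⟩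
  -- For `w` in the window, monotonicity bounds the empirical value by those at `a` and `b`. Three
  -- errors `η / 3` add up: sampling at an endpoint, endpoint to centre, centre to `w`.
  · filter_upwards [hkpos] with n hn ω ⟨hu, hl⟩ w hw
    have hmono := empCondCdf_mono (fun i => X i ω) (fun i => Y i ω) n hn
    have e1 := abs_lt.1 (hwin w hw)
    have e2 := abs_lt.1 (hwin a ⟨le_rfl, hav.trans hvb⟩)
    have e3 := abs_lt.1 (hwin b ⟨hav.trans hvb, le_rfl⟩)
    have e4 := hmono hw.1
    have e5 := hmono hw.2
    rw [abs_le]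
    constructor <;> linarith [e1.1, e1.2, e2.1, e2.2, e3.1, e3.2]

end Sample

/-! ### Stability of generalized inverses. -/

section Inverse

/-- Generalized inverses at `q` converge as soon as the nondecreasing functions converge pointwise
on `(0,1)` to a function which is continuous on `[0,1]`, strictly increasing on `(0,1)` and
takes a value below and a value above `q`. -/
lemma exists_genInv_close {G₀ : ℝ → ℝ} (hcont : ContinuousOn G₀ (Icc 0 1))
    (hstrict : StrictMonoOn G₀ (Ioo 0 1)) {q : ℝ} (h0 : G₀ 0 < q) (h1 : q < G₀ 1)
    {ε : ℝ} (hε : 0 < ε) :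
    ∃ v₀ : ℝ, ∃ a ∈ Ioo (0 : ℝ) 1, ∃ b ∈ Ioo (0 : ℝ) 1, ∃ δ > 0, ∀ G : ℝ → ℝ,
      MonotoneOn G (Icc 0 1) → |G a - G₀ a| < δ → |G b - G₀ b| < δ →
        |genInv G q - v₀| < ε := by
  obtain ⟨v₀, hv₀, hG⟩ : ∃ v₀ ∈ Ioo (0 : ℝ) 1, G₀ v₀ = q :=
    intermediate_value_Ioo zero_le_one hcont ⟨h0, h1⟩
  obtain ⟨a, ha, hav⟩ := exists_between (max_lt hv₀.1 (sub_lt_self v₀ hε))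
  obtain ⟨b, hvb, hb⟩ := exists_between (lt_min hv₀.2 (lt_add_of_pos_right v₀ hε))
  obtain ⟨ha0, haε⟩ := max_lt_iff.1 ha
  obtain ⟨hb1, hbε⟩ := lt_min_iff.1 hb
  have ha' : a ∈ Ioo (0 : ℝ) 1 := ⟨ha0, hav.trans hv₀.2⟩
  have hb' : b ∈ Ioo (0 : ℝ) 1 := ⟨hv₀.1.trans hvb, hb1⟩
  have hGa := hstrict ha' hv₀ hav
  have hGb := hstrict hv₀ hb' hvb
  rw [hG] at hGa hGb
  -- This `δ` keeps `G a < q < G b`; only the two points `a`, `b` matter, hence pointwise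
  -- convergence suffices.
  refine ⟨v₀, a, ha', b, hb', min (q - G₀ a) (G₀ b - q), lt_min (by linarith) (by linarith),
    fun G hGm hda hdb => ?_⟩
  have hda' := (abs_lt.1 (hda.trans_le (min_le_left _ _))).2
  have hdb' := (abs_lt.1 (hdb.trans_le (min_le_right _ _))).1
  have := genInv_mem_Icc hGm (Ioo_subset_Icc_self ha') (Ioo_subset_Icc_self hb')
    (q := q) (by linarith) (by linarith)
  rw [abs_lt]
  constructor <;> linarith [this.1, this.2]

end Inverse

/-! ### From the `L¹` criterion to the model. -/

section Criterion

variable {E : Type*}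

lemma intervalIntegrable_empCondCdf_sub {A : ℝ → E → ℝ} (x y : ℕ → ℝ) (n : ℕ) {k : ℝ}
    (hk : 0 ≤ k) {θ : E} (hA : ContinuousOn (fun v => A v θ) (Icc 0 1)) :
    IntervalIntegrable (fun v => |empCondCdf x y n k v - A v θ|) volume 0 1 := by
  refine (((empCondCdf_mono x y n hk).intervalIntegrable).sub
    (ContinuousOn.intervalIntegrable ?_)).abs
  rwa [uIcc_of_le zero_le_one]

/-- A minimizer of the criterion is `L¹`-close to any member of the model that is uniformly close
to the empirical conditional distribution function. -/
lemma integral_abs_sub_le_of_isMinDistEstimate {Θ : Set E} {A : ℝ → E → ℝ} {x y : ℕ → ℝ} {n : ℕ}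
    {k : ℝ} (hk : 0 ≤ k) (hA : ∀ θ ∈ Θ, ContinuousOn (fun v => A v θ) (Icc 0 1)) {θ θ₀ : E}
    (hθ₀ : θ₀ ∈ Θ) (hmin : IsMinDistEstimate Θ A x y n k θ) {η : ℝ}
    (hη : ∀ v ∈ Icc (0 : ℝ) 1, |empCondCdf x y n k v - A v θ₀| ≤ η) :
    ∫ v in (0 : ℝ)..1, |A v θ - A v θ₀| ≤ 2 * η := by
  have hint := intervalIntegrable_empCondCdf_sub x y n hk (hA θ hmin.1)
  have hint₀ := intervalIntegrable_empCondCdf_sub x y n hk (hA θ₀ hθ₀)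
  have hcrit : criterion A x y n k θ₀ ≤ η := by
    calc _ ≤ ∫ _ in (0 : ℝ)..1, η :=
          intervalIntegral.integral_mono_on zero_le_one hint₀ (by simp) hη
      _ = η := by simp
  have hle := hmin.2 θ₀ hθ₀
  have hdiff : IntervalIntegrable (fun v => |A v θ - A v θ₀|) volume 0 1 := by
    refine (ContinuousOn.intervalIntegrable ?_).abs
    rw [uIcc_of_le zero_le_one]
    exact (hA θ hmin.1).sub (hA θ₀ hθ₀)
  calc ∫ v in (0 : ℝ)..1, |A v θ - A v θ₀|
      ≤ ∫ v in (0 : ℝ)..1, (|empCondCdf x y n k v - A v θ| + |empCondCdf x y n k v - A v θ₀|) := by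
        refine intervalIntegral.integral_mono_on zero_le_one hdiff (hint.add hint₀) fun v _ => ?_
        rw [abs_sub_comm (empCondCdf x y n k v) (A v θ)]
        exact abs_sub_le _ _ _
    _ = criterion A x y n k θ + criterion A x y n k θ₀ :=
        intervalIntegral.integral_add hint hint₀
    _ ≤ 2 * η := by linarith

end Criterion

/-- The uniform limit of `v ↦ C(p, v) / p` has no atom at `0`. -/
lemma limit_copula_zero {F : Measure (ℝ × ℝ)} [IsProbabilityMeasure F]
    (hFY : Continuous (cdf F.snd)) {A₀ : ℝ → ℝ}
    (hspec : TendstoUniformlyOn (fun p v => copula F p v / p) A₀ (𝓝[>] (0 : ℝ)) (Ioo 0 1))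
    (hcont : ContinuousWithinAt A₀ (Icc 0 1) 0) (h0 : 0 ≤ A₀ 0) : A₀ 0 = 0 := by
  refine le_antisymm (le_of_forall_pos_le_add fun ε hε => ?_) h0
  -- Uniformity in `v` allows `p` to be frozen before `v ↓ 0`; then `C(p, v)/p ≤ v/p` vanishes.
  obtain ⟨p, hp, hp0⟩ :=
    ((Metric.tendstoUniformlyOn_iff.1 hspec ε hε).and self_mem_nhdsWithin).exists
  have hp0' : 0 < p := hp0
  have hlim : Tendsto A₀ (𝓝[Ioo 0 1] 0) (𝓝 (A₀ 0)) := hcont.mono Ioo_subset_Icc_self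
  have hlim2 : Tendsto (fun v : ℝ => v / p + ε) (𝓝[Ioo 0 1] 0) (𝓝 (0 + ε)) :=
    (Continuous.tendsto' (by fun_prop) _ _ (by simp)).mono_left nhdsWithin_le_nhds
  have : (𝓝[Ioo (0 : ℝ) 1] 0).NeBot := left_nhdsWithin_Ioo_neBot one_pos
  refine le_of_tendsto_of_tendsto hlim hlim2 ?_
  filter_upwards [self_mem_nhdsWithin] with v hv
  have h1 := (abs_lt.1 (Real.dist_eq _ _ ▸ hp v hv)).2
  have h2 : copula F p v / p ≤ v / p :=
    div_le_div_of_nonneg_right (copula_le_right F hFY p hv) hp0'.le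
  linarith

end CoVaR

/-! ### Consistency of the estimator and of the adjusted level. -/

open CoVaR in
theorem mainTheorem7
    {Ω : Type*} [MeasurableSpace Ω] (P : Measure Ω) [IsProbabilityMeasure P]
    -- the i.i.d. sample `(X_i, Y_i)`, with common law `F` having continuous margins
    (F : Measure (ℝ × ℝ)) [IsProbabilityMeasure F]
    (hFX : Continuous (cdf F.fst)) (hFY : Continuous (cdf F.snd))
    (X Y : ℕ → Ω → ℝ) (hX : ∀ i, Measurable (X i)) (hY : ∀ i, Measurable (Y i))
    (hindep : iIndepFun (fun i ω => (X i ω, Y i ω)) P)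
    (hlaw : ∀ i, P.map (fun ω => (X i ω, Y i ω)) = F)
    -- the parametric model on a closed and bounded parameter set
    {d : ℕ} (Θ : Set (EuclideanSpace ℝ (Fin d)))
    (hclosed : IsClosed Θ) (hbdd : Bornology.IsBounded Θ)
    (A : ℝ → EuclideanSpace ℝ (Fin d) → ℝ)
    (θ₀ : EuclideanSpace ℝ (Fin d)) (hθ₀ : θ₀ ∈ Θ)
    -- correct specification of the boundary distribution function
    (hspec : TendstoUniformlyOn (fun p v => CoVaR.copula F p v / p) (fun v => A v θ₀)
      (𝓝[>] (0 : ℝ)) (Ioo 0 1))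
    -- regularity of the model
    (hcdf : ∀ θ ∈ Θ, CoVaR.IsProperCdf (fun v => A v θ))
    (hstrict : ∀ θ ∈ Θ, StrictMonoOn (fun v => A v θ) (Ioo 0 1))
    (hcont : ContinuousOn (fun z : ℝ × EuclideanSpace ℝ (Fin d) => A z.1 z.2)
      (Icc (0 : ℝ) 1 ×ˢ Θ))
    -- `L¹` identifiability
    (hident : ∀ ε > 0, ∃ δ > 0, ∀ θ ∈ Θ, ε ≤ ‖θ - θ₀‖ →
      δ ≤ ∫ v in (0 : ℝ)..1, |A v θ - A v θ₀|)
    -- the intermediate sequence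
    (k : ℕ → ℝ) (hk : Tendsto k atTop atTop)
    (hkn : Tendsto (fun n : ℕ => k n / n) atTop (𝓝 0))
    (hksqrt : Tendsto (fun n : ℕ => k n / Real.sqrt n) atTop atTop)
    -- any minimizer of the criterion
    (θhat : ℕ → Ω → EuclideanSpace ℝ (Fin d))
    (hmin : ∀ n, ∀ᵐ ω ∂P, CoVaR.IsMinDistEstimate Θ A (fun i => X i ω) (fun i => Y i ω) n (k n)
      (θhat n ω)) :
    TendstoInMeasure P θhat atTop (fun _ => θ₀) ∧
    ∀ q ∈ Ioo (0 : ℝ) 1,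
      TendstoInMeasure P
        (fun (n : ℕ) ω => CoVaR.genInv (fun v => A v (θhat n ω)) q
          - CoVaR.adjustedLevel (CoVaR.copula F) q (k n / n))
        atTop (fun _ => 0) := by
  
  have hs : IsSample P F X Y := ⟨hX, hY, hindep, hlaw⟩
  have hki : IsIntermediate k := ⟨hk, hkn, hksqrt⟩
  have hAv : ∀ θ ∈ Θ, ContinuousOn (fun v => A v θ) (Icc 0 1) := fun θ hθ =>
    hcont.comp (f := fun v => (v, θ)) (Continuous.continuousOn (by fun_prop)) fun v hv => ⟨hv, hθ⟩
  have hzero : A 0 θ₀ = 0 := limit_copula_zero hFY hspec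
    (hAv θ₀ hθ₀ 0 (left_mem_Icc.2 zero_le_one)) (hcdf θ₀ hθ₀).nonneg
  have hone : A 1 θ₀ = 1 := (hcdf θ₀ hθ₀).at_one
  have hlim : ∀ v ∈ Ioo (0 : ℝ) 1,
      Tendsto (fun p => copula F p v / p) (𝓝[>] 0) (𝓝 (A v θ₀)) := fun v hv =>
    hspec.tendsto_at hv
  have hest := HoldsWHP.of_ae hmin
  have hkpos : ∀ᶠ n in atTop, 0 ≤ k n := hk.eventually_ge_atTop 0
  -- Membership in `Θ` is carried along because continuity and monotonicity of the model are only
  -- available there.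
  have hcons : ∀ ε > 0, HoldsWHP P fun n ω => θhat n ω ∈ Θ ∧ ‖θhat n ω - θ₀‖ < ε := by
    intro ε hε
    obtain ⟨δ, hδ, hsep⟩ := hident ε hε
    -- Uniform error `δ / 4` yields `L¹` distance at most `δ / 2`, below the separation `δ`.
    refine (hest.and (hs.holdsWHP_abs_empCondCdf_sub_le hki hFX hFY hlim (hAv θ₀ hθ₀) hzero hone
      (by linarith : 0 < δ / 4))).mono ?_
    filter_upwards [hkpos] with n hn ω ⟨h1, h2⟩
    refine ⟨h1.1, ?_⟩
    by_contra! hfar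
    have := hsep _ h1.1 hfar
    have := integral_abs_sub_le_of_isMinDistEstimate hn hAv hθ₀ h1 h2
    linarith
  refine ⟨?_, fun q hq => ?_⟩
  · rw [tendstoInMeasure_iff_norm]
    intro ε hε
    have := (hcons ε hε).mono (Eventually.of_forall fun n ω h => h.2)
    simpa only [HoldsWHP, not_lt] using this
  · rw [tendstoInMeasure_iff_norm]
    intro ε hε
    obtain ⟨v₀, a, ha, b, hb, δ, hδ, hclose⟩ := exists_genInv_close (hAv θ₀ hθ₀)
      (hstrict θ₀ hθ₀) (q := q) (hzero.trans_lt hq.1) (hq.2.trans_eq hone.symm) (half_pos hε)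
    -- The true level is deterministic and is compared with the same `v₀` as the fitted one, through
    -- the same `a`, `b`, `δ`.
    have hpop : ∀ᶠ n in atTop, |adjustedLevel (copula F) q (k n / n) - v₀| < ε / 2 := by
      have hpt : ∀ v ∈ Ioo (0 : ℝ) 1, ∀ᶠ n : ℕ in atTop,
          |condCopula (copula F) (k n / n) v - A v θ₀| < δ := fun v hv =>
        ((hlim v hv).comp hki.tendsto_nhdsGT).eventually (Metric.ball_mem_nhds _ hδ)
      filter_upwards [hpt a ha, hpt b hb, hki.tendsto_nhdsGT self_mem_nhdsWithin]
        with n h1 h2 h3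
      refine hclose _ (fun v _ w _ hvw => ?_) h1 h2
      exact div_le_div_of_nonneg_right (copula_mono_right F _ hvw) (le_of_lt h3)
    have hpar : ∀ v ∈ Ioo (0 : ℝ) 1, HoldsWHP P fun n ω =>
        θhat n ω ∈ Θ ∧ |A v (θhat n ω) - A v θ₀| < δ := by
      intro v hv
      have hθ : ContinuousOn (fun θ => A v θ) Θ :=
        hcont.comp (f := fun θ => (v, θ)) (Continuous.continuousOn (by fun_prop))
          fun θ h => ⟨Ioo_subset_Icc_self hv, h⟩
      obtain ⟨r, hr, hball⟩ := Metric.continuousOn_iff.1 hθ θ₀ hθ₀ δ hδ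
      refine (hcons r hr).mono (Eventually.of_forall fun n ω h => ⟨h.1, ?_⟩)
      exact hball _ h.1 (by rw [dist_eq_norm]; exact h.2)
    have hfinal : HoldsWHP P fun n ω =>
        ‖genInv (fun v => A v (θhat n ω)) q - adjustedLevel (copula F) q (k n / n) - 0‖ < ε := by
      refine ((hpar a ha).and (hpar b hb)).mono ?_
      filter_upwards [hpop] with n hn ω ⟨h1, h2⟩
      have := hclose (fun v => A v (θhat n ω)) (hcdf _ h1.1).mono h1.2 h2.2
      rw [sub_zero, Real.norm_eq_abs, abs_lt]
      rw [abs_lt] at this hn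
      constructor <;> linarith [this.1, this.2, hn.1, hn.2]
    simpa only [HoldsWHP, not_lt] using hfinal
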